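/- Let $n\ge 1$ be an integer, $s\in(0,1)$, $p>1$ with $n>sp$, and let $\Omega\subset\mathbb R^n$ be bounded and open. Write $v_+=\max\{v,0\}$, $v_-=\max\{-v,0\}$, let $B_R(x_0)$ be the open ball, and put $$[v]_{W^{s,p}(U)}=\Big(\int_U\int_U\frac{|v(x)-v(y)|^p}{|x-y|^{n+sp}}\,dx\,dy\Big)^{1/p},\qquad \mathrm{Tail}_{s,p}(v;x_0,R)=\Big(R^{sp}\int_{\mathbb R^n\setminus B_R(x_0)}\frac{|v(x)|^{p-1}}{|x-x_0|^{n+sp}}\,dx\Big)^{\frac1{p-1}},$$ $\overline{\mathrm{Tail}}_{s,p}(v;x_0,R)=R^{-\frac{sp}{p-1}}\,\mathrm{Tail}_{s,p}(v;x_0,R)$. Let $d,\lambda\ge0$ and $H\ge1$. The class $\mathrm{wDG}^{\pm}(\Omega;d,H,\lambda)$ consists of the measurable functions $u:\mathbb R^n\to\mathbb R$ with $\int_{\mathbb R^n}\frac{|u(x)|^{p-1}}{(1+|x|)^{n+sp}}\,dx<\infty$, $u\in L^p(\Omega)$ and $[u]_{W^{s,p}(\Omega)}<\infty$, such that $$[(u-k)_\pm]_{W^{s,p}(B_r(x_0))}^p\le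 H\Big\{R^\lambda d^p\,|A^\pm_k\cap B_R(x_0)|+\frac{R^{(1-s)p}}{(R-r)^p}\|(u-k)_\pm\|^p_{L^p(B_R(x_0))}+\frac{R^{n+sp}}{(R-r)^{n+sp}}\|(u-k)_\pm\|_{L^1(B_R(x_0))}\,\overline{\mathrm{Tail}}_{s,p}((u-k)_\pm;x_0,r)^{p-1}\Big\}$$ for all $x_0\in\Omega$, $0<r<R<\mathrm{dist}(x_0,\partial\Omega)$ and $k\in\mathbb R$, where $A^+_k=\{u>k\}$ and $A^-_k=\{u<k\}$. Set $\mathrm{wDG}(\Omega;d,H,\lambda)=\mathrm{wDG}^+(\Omega;d,H,\lambda)\cap\mathrm{wDG}^-(\Omega;d,H,\lambda)$. **Theorem.** (i) There is a constant $C\ge1$ depending only on $n,s,p,H$ such that every $u\in\mathrm{wDG}(\Omega;d,H,\lambda)$ belongs to $L^\infty_{\mathrm{loc}}(\Omega)$ and satisfies $$\|u\|_{L^\infty(B_R(x_0))}\le C\Big\{\Big(\frac1{|B_{2R}(x_0)|}\int_{B_{2R}(x_0)}|u|^p\,dx\Big)^{1/p}+\mathrm{Tail}_{s,p}(u;x_0,R)+R^{\frac{\lambda+sp}{p}}d\Big\}$$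 for every $x_0\in\Omega$ and $0<R<\mathrm{dist}(x_0,\partial\Omega)/2$. (ii) There is a constant $C\ge1$ depending only on $n,s,p,H$ such that every $u\in\mathrm{wDG}^+(\Omega;d,H,\lambda)$ satisfies $$\operatorname*{ess\,sup}_{B_R(x_0)}u\le C\Big\{\Big(\frac1{|B_{2R}(x_0)|}\int_{B_{2R}(x_0)}u_+^p\,dx\Big)^{1/p}+\mathrm{Tail}_{s,p}(u_+;x_0,R)+R^{\frac{\lambda+sp}{p}}d\Big\}$$ for every $x_0\in\Omega$ and $0<R<\mathrm{dist}(x_0,\partial\Omega)/2$. -/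

import Mathlib

open MeasureTheory
open scoped ENNReal NNReal

noncomputable section

namespace FracDeGiorgi

/-- The Gagliardo seminorm
`[u]_{W^{s,p}(U)} = (∫_U ∫_U |u x - u y|^p / |x - y|^(n + s p) dx dy)^(1/p)`, with values in `[0, ∞]`. -/
def gagliardoSeminorm {n : ℕ} (s p : ℝ) (u : EuclideanSpace ℝ (Fin n) → ℝ)
    (U : Set (EuclideanSpace ℝ (Fin n))) : ℝ≥0∞ :=
  (∫⁻ x in U, ∫⁻ y in U, ‖u x - u y‖ₑ ^ p / ‖x - y‖ₑ ^ ((n : ℝ) + s * p)) ^ (1 / p)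

/-- Membership of `u|_U` in the fractional Sobolev space `W^{s,p}(U)`. -/
def MemFracSobolev {n : ℕ} (s p : ℝ) (u : EuclideanSpace ℝ (Fin n) → ℝ)
    (U : Set (EuclideanSpace ℝ (Fin n))) : Prop :=
  MemLp u (ENNReal.ofReal p) (volume.restrict U) ∧ gagliardoSeminorm s p u U < ∞

/-- Membership in the weighted Lebesgue space `L^{p-1}_s(ℝⁿ)`: `u` is (Lebesgue) measurable and
`∫ |u x|^(p-1) / (1 + |x|)^(n + s p) dx < ∞`. -/
def MemTailSpace {n : ℕ} (s p : ℝ) (u : EuclideanSpace ℝ (Fin n) → ℝ) : Prop :=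
  AEMeasurable u volume ∧
    ∫⁻ x, ‖u x‖ₑ ^ (p - 1) / (1 + ‖x‖ₑ) ^ ((n : ℝ) + s * p) < ∞

/-- `Tail_{s,p}(u; x₀, R) = (R^(s p) ∫_{ℝⁿ ∖ B_R(x₀)} |u x|^(p-1) / |x - x₀|^(n + s p) dx)^(1/(p-1))`,
with values in `[0, ∞]`; it is finite for `R > 0` when `u` lies in `L^{p-1}_s(ℝⁿ)`. -/
def tail {n : ℕ} (s p : ℝ) (u : EuclideanSpace ℝ (Fin n) → ℝ)
    (x₀ : EuclideanSpace ℝ (Fin n)) (R : ℝ) : ℝ≥0∞ :=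
  (ENNReal.ofReal (R ^ (s * p)) *
    ∫⁻ x in (Metric.ball x₀ R)ᶜ, ‖u x‖ₑ ^ (p - 1) / ‖x - x₀‖ₑ ^ ((n : ℝ) + s * p)) ^ (1 / (p - 1))

/-- The rescaled tail `R^(- s p / (p - 1)) Tail_{s,p}(u; x₀, R)`. -/
def tailBar {n : ℕ} (s p : ℝ) (u : EuclideanSpace ℝ (Fin n) → ℝ)
    (x₀ : EuclideanSpace ℝ (Fin n)) (R : ℝ) : ℝ≥0∞ :=
  ENNReal.ofReal (R ^ (-(s * p / (p - 1)))) * tail s p u x₀ R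

/-- The nonlocal Caccioppoli inequality on the balls `B_r(x₀) ⊆ B_R(x₀)` for a truncation `v`
with corresponding level set `A`. It is used with `v = (u - k)₊`, `A = {u > k}` and with
`v = (u - k)₋`, `A = {u < k}`. -/
def CaccioppoliIneq {n : ℕ} (s p d H lam : ℝ) (v : EuclideanSpace ℝ (Fin n) → ℝ)
    (A : Set (EuclideanSpace ℝ (Fin n))) (x₀ : EuclideanSpace ℝ (Fin n)) (r R : ℝ) : Prop :=
  gagliardoSeminorm s p v (Metric.ball x₀ r) ^ p ≤
    ENNReal.ofReal H *
      (ENNReal.ofReal (R ^ lam * d ^ p) * volume (A ∩ Metric.ball x₀ R)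
        + ENNReal.ofReal (R ^ ((1 - s) * p) / (R - r) ^ p)
          * eLpNorm v (ENNReal.ofReal p) (volume.restrict (Metric.ball x₀ R)) ^ p
        + ENNReal.ofReal (R ^ ((n : ℝ) + s * p) / (R - r) ^ ((n : ℝ) + s * p))
          * eLpNorm v 1 (volume.restrict (Metric.ball x₀ R))
          * tailBar s p v x₀ r ^ (p - 1))

/-- `wDG⁺(Ω; d, H, λ)`. -/
structure MemWDGPlus {n : ℕ} (s p d H lam : ℝ) (Ω : Set (EuclideanSpace ℝ (Fin n)))
    (u : EuclideanSpace ℝ (Fin n) → ℝ) : Prop where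
  memTailSpace : MemTailSpace s p u
  memFracSobolev : MemFracSobolev s p u Ω
  caccioppoli : ∀ x₀ ∈ Ω, ∀ r R : ℝ, 0 < r → r < R → R < Metric.infDist x₀ (frontier Ω) →
    ∀ k : ℝ, CaccioppoliIneq s p d H lam (fun x => max (u x - k) 0) {x | k < u x} x₀ r R

/-- `wDG⁻(Ω; d, H, λ)`. -/
structure MemWDGMinus {n : ℕ} (s p d H lam : ℝ) (Ω : Set (EuclideanSpace ℝ (Fin n)))
    (u : EuclideanSpace ℝ (Fin n) → ℝ) : Prop where
  memTailSpace : MemTailSpace s p u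
  memFracSobolev : MemFracSobolev s p u Ω
  caccioppoli : ∀ x₀ ∈ Ω, ∀ r R : ℝ, 0 < r → r < R → R < Metric.infDist x₀ (frontier Ω) →
    ∀ k : ℝ, CaccioppoliIneq s p d H lam (fun x => max (-(u x - k)) 0) {x | u x < k} x₀ r R

/-- The weak fractional De Giorgi class `wDG(Ω; d, H, λ) = wDG⁺(Ω; d, H, λ) ∩ wDG⁻(Ω; d, H, λ)`. -/
def MemWDG {n : ℕ} (s p d H lam : ℝ) (Ω : Set (EuclideanSpace ℝ (Fin n)))
    (u : EuclideanSpace ℝ (Fin n) → ℝ) : Prop :=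
  MemWDGPlus s p d H lam Ω u ∧ MemWDGMinus s p d H lam Ω u

/-- `u ∈ L^∞_loc(Ω)`. -/
def MemLinftyLoc {n : ℕ} (Ω : Set (EuclideanSpace ℝ (Fin n)))
    (u : EuclideanSpace ℝ (Fin n) → ℝ) : Prop :=
  ∀ K ⊆ Ω, IsCompact K → MemLp u ∞ (volume.restrict K)

end FracDeGiorgi

end

namespace FracDeGiorgi

variable {n : ℕ} {s p : ℝ}

/-! This is De Giorgi's iteration, with the gain at each step taken from a fractional Faber–Krahn
inequality (`lintegral_rpow_le_gagliardoSeminorm`). If `v` vanishes on at least half of some ball of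
radius `ρ / 2` close to every point, comparing `v x` with those zeros bounds `∫ |v|^p` by `ρ^(sp)`
times the seminorm to the power `p`.

Let `Y_j` be the integral of `(u - k_j)₊^p` over `B_{r_j}`, with `k_j` increasing to `k` and `r_j`
decreasing to `R / 2`. Once `k` dominates the tail and the `d` term, Chebyshev turns every term of
the Caccioppoli inequality into `R^(-sp) 2^(jN) Y_j` up to a constant. Chebyshev also makes the next
superlevel set so small that Faber–Krahn applies with `ρ = R ε τ^j`. The factor `ρ^(sp)` absorbs
`2^(jN)`, so `Y_{j+1} ≤ θ Y_j` with `θ < 1`; hence `Y_j → 0` and `u ≤ k` on `B_{R/2}`.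

The lemma is used on `B_R(y)` for each `y ∈ B_R(x₀)`, with `k` a multiple of the right-hand side;
the tail about `y` is controlled by the data about `x₀`. The two-sided bound follows by treating `u`
and `-u`. -/

lemma enorm_max_zero (a : ℝ) : ‖max a 0‖ₑ = ENNReal.ofReal a := by
  rw [Real.enorm_of_nonneg (le_max_right _ _)]
  rcases le_total a 0 with h | h
  · rw [max_eq_right h, ENNReal.ofReal_of_nonpos h, ENNReal.ofReal_zero]
  · rw [max_eq_left h]

/-! ### Tails, seminorms and norms as integrals -/

lemma tail_rpow (hp : 1 < p) (v : EuclideanSpace ℝ (Fin n) → ℝ)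
    (x₀ : EuclideanSpace ℝ (Fin n)) (R : ℝ) :
    tail s p v x₀ R ^ (p - 1) = ENNReal.ofReal (R ^ (s * p)) *
      ∫⁻ x in (Metric.ball x₀ R)ᶜ, ‖v x‖ₑ ^ (p - 1) / ‖x - x₀‖ₑ ^ ((n : ℝ) + s * p) := by
  have h : p - 1 ≠ 0 := by linarith
  rw [tail, ← ENNReal.rpow_mul, one_div, inv_mul_cancel₀ h, ENNReal.rpow_one]

/-- The prefactor of `tailBar` cancels the factor `R^(sp)` of `tail`, which leaves an integral
monotone in the domain. -/
lemma tailBar_rpow (hp : 1 < p) (v : EuclideanSpace ℝ (Fin n) → ℝ)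
    (x₀ : EuclideanSpace ℝ (Fin n)) {R : ℝ} (hR : 0 < R) :
    tailBar s p v x₀ R ^ (p - 1) =
      ∫⁻ x in (Metric.ball x₀ R)ᶜ, ‖v x‖ₑ ^ (p - 1) / ‖x - x₀‖ₑ ^ ((n : ℝ) + s * p) := by
  have h : 0 < p - 1 := by linarith
  rw [tailBar, ENNReal.mul_rpow_of_nonneg _ _ h.le, tail_rpow hp, ← mul_assoc,
    ENNReal.ofReal_rpow_of_nonneg (by positivity) h.le, ← ENNReal.ofReal_mul (by positivity),
    ← Real.rpow_mul hR.le, ← Real.rpow_add hR]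
  have : -(s * p / (p - 1)) * (p - 1) + s * p = 0 := by field_simp; ring
  rw [this, Real.rpow_zero, ENNReal.ofReal_one, one_mul]

lemma gagliardoSeminorm_rpow (hp : 0 < p) (v : EuclideanSpace ℝ (Fin n) → ℝ)
    (U : Set (EuclideanSpace ℝ (Fin n))) :
    gagliardoSeminorm s p v U ^ p =
      ∫⁻ x in U, ∫⁻ y in U, ‖v x - v y‖ₑ ^ p / ‖x - y‖ₑ ^ ((n : ℝ) + s * p) := by
  rw [gagliardoSeminorm, ← ENNReal.rpow_mul, one_div, inv_mul_cancel₀ hp.ne', ENNReal.rpow_one]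

lemma eLpNorm_ofReal_rpow (hp : 0 < p) (v : EuclideanSpace ℝ (Fin n) → ℝ)
    (μ : Measure (EuclideanSpace ℝ (Fin n))) :
    eLpNorm v (ENNReal.ofReal p) μ ^ p = ∫⁻ x, ‖v x‖ₑ ^ p ∂μ := by
  rw [eLpNorm_eq_lintegral_rpow_enorm_toReal (by simpa using hp) ENNReal.ofReal_ne_top,
    ENNReal.toReal_ofReal hp.le, ← ENNReal.rpow_mul, one_div, inv_mul_cancel₀ hp.ne',
    ENNReal.rpow_one]

/-! ### Fractional Faber–Krahn inequality -/

/-- The volume of the unit ball. -/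
noncomputable def unitBallVolume (n : ℕ) : ℝ :=
  volume.real (Metric.ball (0 : EuclideanSpace ℝ (Fin n)) 1)

lemma unitBallVolume_pos (n : ℕ) : 0 < unitBallVolume n :=
  ENNReal.toReal_pos (Metric.measure_ball_pos _ _ one_pos).ne' measure_ball_lt_top.ne

lemma volume_ball_eq (hn : 1 ≤ n) (x : EuclideanSpace ℝ (Fin n)) {r : ℝ} (hr : 0 ≤ r) :
    volume (Metric.ball x r) = ENNReal.ofReal (unitBallVolume n * r ^ n) := by
  have : NeZero n := ⟨by omega⟩
  rw [Measure.addHaar_ball volume x hr, finrank_euclideanSpace_fin, mul_comm,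
    ENNReal.ofReal_mul (unitBallVolume_pos n).le, unitBallVolume, measureReal_def,
    ENNReal.ofReal_toReal measure_ball_lt_top.ne]

/-- A ball of radius `ρ ≤ 2 r` about a point `x` of `B_r(x₀)` meets `B_r(x₀)` in a set that
contains a ball of radius `ρ / 2`. -/
lemma exists_ball_subset_inter_ball {x₀ x : EuclideanSpace ℝ (Fin n)} {r ρ : ℝ} (hρ : 0 < ρ)
    (hρr : ρ ≤ 2 * r) (hx : x ∈ Metric.ball x₀ r) :
    ∃ z, Metric.ball z (ρ / 2) ⊆ Metric.ball x₀ r ∩ Metric.ball x ρ := by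
  have hr : 0 < r := by linarith
  have hq0 : 0 < ρ / (2 * r) := by positivity
  have hq1 : ρ / (2 * r) ≤ 1 := by rw [div_le_one (by positivity)]; exact hρr
  have hqr : ρ / (2 * r) * r = ρ / 2 := by field_simp
  set q := ρ / (2 * r)
  rw [Metric.mem_ball, dist_eq_norm] at hx
  -- The centre is `x` moved towards `x₀`: the shift is at most `q r = ρ / 2`, and what remains is
  -- within `(1 - q) r = r - ρ / 2` of `x₀`.
  refine ⟨x₀ + (1 - q) • (x - x₀), Set.subset_inter ?_ ?_⟩
  · apply Metric.ball_subset_ball'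
    rw [dist_eq_norm, add_sub_cancel_left, norm_smul, Real.norm_of_nonneg (by linarith)]
    nlinarith [norm_nonneg (x - x₀)]
  · apply Metric.ball_subset_ball'
    have : x₀ + (1 - q) • (x - x₀) - x = -(q • (x - x₀)) := by module
    rw [dist_eq_norm, this, norm_neg, norm_smul, Real.norm_of_nonneg hq0.le]
    nlinarith [norm_nonneg (x - x₀)]

/-- A fractional Faber–Krahn inequality: a function vanishing off a set that occupies a small part
of a ball is controlled in `L^p` by its Gagliardo seminorm. -/
lemma lintegral_rpow_le_gagliardoSeminorm (hn : 1 ≤ n) (hp : 0 < p) (hs : 0 ≤ s)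
    {v : EuclideanSpace ℝ (Fin n) → ℝ} {A : Set (EuclideanSpace ℝ (Fin n))}
    (hA : NullMeasurableSet A) (hv : ∀ y ∉ A, v y = 0) {x₀ : EuclideanSpace ℝ (Fin n)} {r ρ : ℝ}
    (hρ : 0 < ρ) (hρr : ρ ≤ 2 * r)
    (hvol : volume (A ∩ Metric.ball x₀ r) ≤
      ENNReal.ofReal (unitBallVolume n * (ρ / 2) ^ n / 2)) :
    ∫⁻ x in Metric.ball x₀ r, ‖v x‖ₑ ^ p ≤
      ENNReal.ofReal (2 ^ (n + 1) / unitBallVolume n * ρ ^ (s * p)) *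
        gagliardoSeminorm s p v (Metric.ball x₀ r) ^ p := by
  have hω := unitBallVolume_pos n
  have hN : 0 ≤ (n : ℝ) + s * p := by positivity
  rw [gagliardoSeminorm_rpow hp, ← lintegral_const_mul' _ _ ENNReal.ofReal_ne_top]
  refine setLIntegral_mono' measurableSet_ball fun x hx => ?_
  obtain ⟨z, hz⟩ := exists_ball_subset_inter_ball hρ hρr hx
  -- On `S` the function vanishes and `|x - y| < ρ`. Since `A` fills at most half the volume of the
  -- small ball, `S` keeps at least half.
  set S := Metric.ball z (ρ / 2) \ (A ∩ Metric.ball x₀ r) with hS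
  have hSm : NullMeasurableSet S :=
    measurableSet_ball.nullMeasurableSet.diff (hA.inter measurableSet_ball.nullMeasurableSet)
  have hSvol : ENNReal.ofReal (unitBallVolume n * (ρ / 2) ^ n / 2) ≤ volume S := by
    refine le_trans ?_ le_measure_sdiff
    rw [volume_ball_eq hn z (by positivity)]
    refine le_trans ?_ (tsub_le_tsub_left hvol _)
    rw [← ENNReal.ofReal_sub _ (by positivity)]
    exact ENNReal.ofReal_le_ofReal (by linarith)
  have hlow : ‖v x‖ₑ ^ p / ENNReal.ofReal (ρ ^ ((n : ℝ) + s * p)) * volume S ≤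
      ∫⁻ y in Metric.ball x₀ r, ‖v x - v y‖ₑ ^ p / ‖x - y‖ₑ ^ ((n : ℝ) + s * p) := by
    rw [← setLIntegral_const]
    refine le_trans ?_ (lintegral_mono_set (s := S) fun y hy => (hz hy.1).1)
    refine lintegral_mono_ae ?_
    rw [ae_restrict_iff'₀ hSm]
    refine Filter.Eventually.of_forall fun y hy => ?_
    have hyA : y ∉ A := fun h => hy.2 ⟨h, (hz hy.1).1⟩
    rw [hv y hyA, sub_zero]
    refine ENNReal.div_le_div_left ?_ _
    rw [← ENNReal.ofReal_rpow_of_nonneg hρ.le hN]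
    refine ENNReal.rpow_le_rpow ?_ hN
    rw [← ofReal_norm]
    have := (hz hy.1).2
    rw [Metric.mem_ball', dist_eq_norm] at this
    exact ENNReal.ofReal_le_ofReal this.le
  refine le_trans ?_ (mul_le_mul_right hlow _)
  refine le_trans ?_ (mul_le_mul_right (mul_le_mul_right hSvol _) _)
  rw [ENNReal.div_eq_inv_mul, ← ENNReal.ofReal_inv_of_pos (by positivity)]
  have : ∀ a b c : ℝ, 0 ≤ a → 0 ≤ b → ∀ X, ENNReal.ofReal a * (ENNReal.ofReal b * X *
      ENNReal.ofReal c) = ENNReal.ofReal (a * (b * c)) * X := fun a b c ha hb X => by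
    rw [ENNReal.ofReal_mul ha, ENNReal.ofReal_mul hb]
    ring
  rw [this _ _ _ (by positivity) (by positivity)]
  have h1 : 2 ^ (n + 1) / unitBallVolume n * ρ ^ (s * p) *
        ((ρ ^ ((n : ℝ) + s * p))⁻¹ * (unitBallVolume n * (ρ / 2) ^ n / 2)) = 1 := by
    rw [Real.rpow_add hρ, Real.rpow_natCast]
    have := (Real.rpow_pos_of_pos hρ (s * p)).ne'
    rw [div_pow]
    field_simp
    ring
  rw [h1, ENNReal.ofReal_one, one_mul]

/-! ### Chebyshev bounds and Caccioppoli between two levels -/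

section LevelSets

variable {u : EuclideanSpace ℝ (Fin n) → ℝ} {B : Set (EuclideanSpace ℝ (Fin n))} {k m : ℝ}

lemma volume_superlevel_le (hp : 0 < p) (hu : AEMeasurable u) (hB : MeasurableSet B) (hm : 0 < m) :
    volume ({x | k + m < u x} ∩ B) ≤
      ENNReal.ofReal (m ^ p)⁻¹ * ∫⁻ x in B, ENNReal.ofReal (u x - k) ^ p := by
  have hf : AEMeasurable (fun x => ENNReal.ofReal (u x - k) ^ p) (volume.restrict B) :=
    ((hu.sub_const k).ennreal_ofReal.pow_const p).restrict
  have h := mul_meas_ge_le_lintegral₀ hf (ENNReal.ofReal (m ^ p))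
  have hsub : volume ({x | k + m < u x} ∩ B) ≤
      volume.restrict B {x | ENNReal.ofReal (m ^ p) ≤ ENNReal.ofReal (u x - k) ^ p} := by
    rw [← Measure.restrict_apply' hB]
    refine measure_mono fun x hx => ?_
    simp only [Set.mem_ofPred_eq] at hx ⊢
    rw [← ENNReal.ofReal_rpow_of_nonneg hm.le hp.le]
    exact ENNReal.rpow_le_rpow (ENNReal.ofReal_le_ofReal (by linarith)) hp.le
  have hpos : 0 < m ^ p := by positivity
  calc volume ({x | k + m < u x} ∩ B)
      = ENNReal.ofReal (m ^ p)⁻¹ * (ENNReal.ofReal (m ^ p) * volume ({x | k + m < u x} ∩ B)) := by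
        rw [← mul_assoc, ← ENNReal.ofReal_mul (by positivity), inv_mul_cancel₀ hpos.ne',
          ENNReal.ofReal_one, one_mul]
    _ ≤ _ := by gcongr; exact (mul_le_mul_right hsub _).trans h

/-- Where the left integrand is nonzero, `u - k ≥ m`, so one factor `u - k` costs `m^(1-p)` of its
`p`-th power. -/
lemma lintegral_truncation_le (hp : 1 < p) (hm : 0 < m) :
    ∫⁻ x in B, ENNReal.ofReal (u x - (k + m)) ≤
      ENNReal.ofReal (m ^ (p - 1))⁻¹ * ∫⁻ x in B, ENNReal.ofReal (u x - k) ^ p := by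
  rw [← lintegral_const_mul' _ _ ENNReal.ofReal_ne_top]
  refine lintegral_mono fun x => ?_
  rcases le_total (u x) (k + m) with h | h
  · rw [ENNReal.ofReal_of_nonpos (by linarith)]; exact zero_le
  · have h0 : 0 < u x - k := by linarith
    rw [ENNReal.ofReal_rpow_of_nonneg h0.le (by linarith), ← ENNReal.ofReal_mul (by positivity)]
    refine ENNReal.ofReal_le_ofReal ?_
    rw [inv_mul_eq_div, le_div_iff₀ (by positivity)]
    calc (u x - (k + m)) * m ^ (p - 1) ≤ (u x - k) * (u x - k) ^ (p - 1) := by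
          gcongr <;> linarith
      _ = (u x - k) ^ p := by
          rw [mul_comm, ← Real.rpow_add_one h0.ne', sub_add_cancel]

end LevelSets

/-- The Caccioppoli inequality between two levels, with all its terms absorbed in the `L^p` norm of
the truncation at the lower level. -/
lemma CaccioppoliIneq.gagliardoSeminorm_rpow_le {d H lam : ℝ}
    {u : EuclideanSpace ℝ (Fin n) → ℝ} {x₀ : EuclideanSpace ℝ (Fin n)} {R r₁ r₂ k κ m σ : ℝ}
    (hs0 : 0 < s) (hs1 : s < 1) (hp : 1 < p) (hH : 0 ≤ H) (hd : 0 ≤ d) (hlam : 0 ≤ lam)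
    (hu : AEMeasurable u) (hR : 0 < R) (hr₁ : R / 2 ≤ r₁) (hr₂ : r₂ ≤ R) (hσ : 0 < σ)
    (hσ1 : σ ≤ 1) (hr : σ * R ≤ r₂ - r₁) (hk : 0 < k) (hm : σ * k ≤ m) (hκ : 0 ≤ κ)
    (hdk : R ^ lam * d ^ p ≤ R ^ (-(s * p)) * k ^ p)
    (htail : ∫⁻ x in (Metric.ball x₀ (R / 2))ᶜ,
      ENNReal.ofReal (u x) ^ (p - 1) / ‖x - x₀‖ₑ ^ ((n : ℝ) + s * p) ≤
        ENNReal.ofReal (R ^ (-(s * p)) * k ^ (p - 1)))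
    (h : CaccioppoliIneq s p d H lam (fun x => max (u x - (κ + m)) 0) {x | κ + m < u x} x₀ r₁ r₂) :
    gagliardoSeminorm s p (fun x => max (u x - (κ + m)) 0) (Metric.ball x₀ r₁) ^ p ≤
      ENNReal.ofReal (3 * H * (R ^ (-(s * p)) * σ ^ (-((n : ℝ) + s * p + p)))) *
        ∫⁻ x in Metric.ball x₀ r₂, ENNReal.ofReal (u x - κ) ^ p := by
  have hm0 : 0 < m := lt_of_lt_of_le (by positivity) hm
  have hσR : 0 < σ * R := by positivity
  have hrr : 0 < r₂ - r₁ := by linarith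
  have hr₁0 : 0 < r₁ := by linarith
  have hr₂0 : 0 < r₂ := by linarith
  have hsp : 0 < s * p := by positivity
  have hp0 : 0 < p := by linarith
  have hp1 : 0 < p - 1 := by linarith
  have hn0 : (0 : ℝ) ≤ n := by positivity
  -- The three terms produce the powers `p`, `p` and `n + sp + p - 1` of `1 / σ`; as `σ ≤ 1`, one
  -- common larger exponent serves for all.
  have hpow : ∀ a : ℝ, a ≤ (n : ℝ) + s * p + p → σ ^ (-a) ≤ σ ^ (-((n : ℝ) + s * p + p)) :=
    fun a ha => Real.rpow_le_rpow_of_exponent_ge hσ hσ1 (by linarith)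
  set N := (n : ℝ) + s * p + p
  set Y := ∫⁻ x in Metric.ball x₀ r₂, ENNReal.ofReal (u x - κ) ^ p
  set E := R ^ (-(s * p)) * σ ^ (-N) with hE
  have hRs : 0 < R ^ (-(s * p)) := by positivity
  have hE0 : 0 ≤ E := by positivity
  rw [CaccioppoliIneq] at h
  refine h.trans ?_
  rw [show 3 * H * E = H * (3 * E) by ring, ENNReal.ofReal_mul hH,
    mul_assoc (ENNReal.ofReal H) (ENNReal.ofReal (3 * E))]
  refine mul_le_mul_right ?_ _
  have e3 : ENNReal.ofReal (3 * E) * Y =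
      ENNReal.ofReal E * Y + ENNReal.ofReal E * Y + ENNReal.ofReal E * Y := by
    rw [ENNReal.ofReal_mul (by norm_num), ENNReal.ofReal_ofNat]
    ring
  rw [e3]
  refine add_le_add (add_le_add ?_ ?_) ?_
  · refine le_trans (mul_le_mul_right
      (volume_superlevel_le hp0 hu measurableSet_ball hm0) _) ?_
    rw [← mul_assoc, ← ENNReal.ofReal_mul (by positivity)]
    refine mul_le_mul_left (ENNReal.ofReal_le_ofReal ?_) _
    calc r₂ ^ lam * d ^ p * (m ^ p)⁻¹ ≤ R ^ lam * d ^ p * ((σ * k) ^ p)⁻¹ := by gcongr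
      _ ≤ R ^ (-(s * p)) * k ^ p * ((σ * k) ^ p)⁻¹ := by gcongr
      _ = R ^ (-(s * p)) * σ ^ (-p) := by
        rw [Real.mul_rpow hσ.le hk.le, Real.rpow_neg hσ.le]
        have := Real.rpow_pos_of_pos hk p
        field_simp
      _ ≤ E := mul_le_mul_of_nonneg_left (hpow _ (by linarith)) hRs.le
  · rw [eLpNorm_ofReal_rpow (by linarith)]
    refine mul_le_mul' (ENNReal.ofReal_le_ofReal ?_) (lintegral_mono fun x => ?_)
    · calc r₂ ^ ((1 - s) * p) / (r₂ - r₁) ^ p ≤ R ^ ((1 - s) * p) / (σ * R) ^ p := by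
            have : 0 ≤ (1 - s) * p := mul_nonneg (by linarith) (by linarith)
            gcongr
        _ = R ^ (-(s * p)) * σ ^ (-p) := by
          rw [Real.mul_rpow hσ.le hR.le, Real.rpow_neg hσ.le,
            show (1 - s) * p = -(s * p) + p by ring, Real.rpow_add hR]
          have := Real.rpow_pos_of_pos hR p
          field_simp
        _ ≤ E := mul_le_mul_of_nonneg_left (hpow _ (by linarith)) hRs.le
    · simp only [enorm_max_zero]
      exact ENNReal.rpow_le_rpow (ENNReal.ofReal_le_ofReal (by linarith)) (by linarith)
  · rw [eLpNorm_one_eq_lintegral_enorm, tailBar_rpow hp _ _ hr₁0]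
    simp only [enorm_max_zero]
    have hT : ∫⁻ x in (Metric.ball x₀ r₁)ᶜ,
        ENNReal.ofReal (u x - (κ + m)) ^ (p - 1) / ‖x - x₀‖ₑ ^ ((n : ℝ) + s * p) ≤
        ENNReal.ofReal (R ^ (-(s * p)) * k ^ (p - 1)) := by
      refine le_trans ?_ htail
      refine (lintegral_mono_set
        (Set.compl_subset_compl.2 (Metric.ball_subset_ball hr₁))).trans ?_
      refine lintegral_mono fun x => ENNReal.div_le_div_right ?_ _
      exact ENNReal.rpow_le_rpow (ENNReal.ofReal_le_ofReal (by linarith)) hp1.le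
    refine (mul_le_mul' (mul_le_mul_right (lintegral_truncation_le hp hm0) _) hT).trans ?_
    rw [mul_right_comm, ← mul_assoc, mul_right_comm, ← ENNReal.ofReal_mul (by positivity),
      mul_right_comm, ← ENNReal.ofReal_mul (by positivity)]
    refine mul_le_mul_left (ENNReal.ofReal_le_ofReal ?_) _
    rw [mul_right_comm]
    calc r₂ ^ ((n : ℝ) + s * p) / (r₂ - r₁) ^ ((n : ℝ) + s * p) * (m ^ (p - 1))⁻¹ *
          (R ^ (-(s * p)) * k ^ (p - 1))
        ≤ R ^ ((n : ℝ) + s * p) / (σ * R) ^ ((n : ℝ) + s * p) * ((σ * k) ^ (p - 1))⁻¹ *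
          (R ^ (-(s * p)) * k ^ (p - 1)) := by gcongr
      _ = R ^ (-(s * p)) * σ ^ (-((n : ℝ) + s * p + (p - 1))) := by
          rw [Real.mul_rpow hσ.le hR.le, Real.mul_rpow hσ.le hk.le, Real.rpow_neg hσ.le,
            Real.rpow_add hσ _ (p - 1)]
          have h1 := Real.rpow_pos_of_pos hR ((n : ℝ) + s * p)
          have h2 := Real.rpow_pos_of_pos hk (p - 1)
          have h3 := Real.rpow_pos_of_pos hσ ((n : ℝ) + s * p)
          field_simp
      _ ≤ E := mul_le_mul_of_nonneg_left (hpow _ (by linarith)) hRs.le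

/-! ### De Giorgi iteration -/

/-- One step of the De Giorgi iteration. -/
lemma lintegral_truncation_rpow_le {d H lam : ℝ} {u : EuclideanSpace ℝ (Fin n) → ℝ}
    {x₀ : EuclideanSpace ℝ (Fin n)} {R r₁ r₂ k κ m σ ρ : ℝ} (hn : 1 ≤ n)
    (hs0 : 0 < s) (hs1 : s < 1) (hp : 1 < p) (hH : 0 ≤ H) (hd : 0 ≤ d) (hlam : 0 ≤ lam)
    (hu : AEMeasurable u) (hR : 0 < R) (hr₁ : R / 2 ≤ r₁) (hr₂ : r₂ ≤ R) (hσ : 0 < σ)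
    (hσ1 : σ ≤ 1) (hr : σ * R ≤ r₂ - r₁) (hk : 0 < k) (hm : σ * k ≤ m) (hκ : 0 ≤ κ)
    (hdk : R ^ lam * d ^ p ≤ R ^ (-(s * p)) * k ^ p)
    (htail : ∫⁻ x in (Metric.ball x₀ (R / 2))ᶜ,
      ENNReal.ofReal (u x) ^ (p - 1) / ‖x - x₀‖ₑ ^ ((n : ℝ) + s * p) ≤
        ENNReal.ofReal (R ^ (-(s * p)) * k ^ (p - 1)))
    (h : CaccioppoliIneq s p d H lam (fun x => max (u x - (κ + m)) 0) {x | κ + m < u x} x₀ r₁ r₂)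
    (hρ : 0 < ρ) (hρR : ρ ≤ R)
    (hvol : ENNReal.ofReal (m ^ p)⁻¹ * ∫⁻ x in Metric.ball x₀ r₂, ENNReal.ofReal (u x - κ) ^ p ≤
      ENNReal.ofReal (unitBallVolume n * (ρ / 2) ^ n / 2)) :
    ∫⁻ x in Metric.ball x₀ r₁, ENNReal.ofReal (u x - (κ + m)) ^ p ≤
      ENNReal.ofReal (2 ^ (n + 1) / unitBallVolume n * ρ ^ (s * p) *
        (3 * H * (R ^ (-(s * p)) * σ ^ (-((n : ℝ) + s * p + p))))) *
        ∫⁻ x in Metric.ball x₀ r₂, ENNReal.ofReal (u x - κ) ^ p := by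
  have hm0 : 0 < m := lt_of_lt_of_le (by positivity) hm
  have hσR : 0 < σ * R := by positivity
  have hω := unitBallVolume_pos n
  have hA : NullMeasurableSet {x | κ + m < u x} := nullMeasurableSet_lt aemeasurable_const hu
  have hFK := lintegral_rpow_le_gagliardoSeminorm hn (by linarith : 0 < p) hs0.le
    (v := fun x => max (u x - (κ + m)) 0) hA
    (fun y hy => max_eq_right (by simp only [Set.mem_ofPred_eq, not_lt] at hy; linarith))
    hρ (by linarith : ρ ≤ 2 * r₁) (x₀ := x₀) <| by
      refine le_trans (measure_mono (Set.inter_subset_inter_right _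
        (Metric.ball_subset_ball (by linarith : r₁ ≤ r₂)))) ?_
      exact (volume_superlevel_le (by linarith) hu measurableSet_ball hm0).trans hvol
  simp only [enorm_max_zero] at hFK
  refine hFK.trans ?_
  rw [ENNReal.ofReal_mul (q := 3 * H * _) (by positivity), mul_assoc]
  exact mul_le_mul_right (h.gagliardoSeminorm_rpow_le hs0 hs1 hp hH hd hlam hu hR hr₁ hr₂ hσ hσ1
    hr hk hm hκ hdk htail) _

/-- The De Giorgi lemma: a function whose positive part has small energy on `B_R(x₀)` relative to
the level `k` lies below `k` on `B_{R/2}(x₀)`. -/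
lemma exists_forall_ae_le_of_lintegral_le (hn : 1 ≤ n) {H : ℝ}
    (hs0 : 0 < s) (hs1 : s < 1) (hp : 1 < p) (hH : 0 < H) :
    ∃ δ : ℝ, 0 < δ ∧ ∀ (d lam : ℝ) (u : EuclideanSpace ℝ (Fin n) → ℝ)
      (x₀ : EuclideanSpace ℝ (Fin n)) (R k : ℝ), 0 ≤ d → 0 ≤ lam → AEMeasurable u → 0 < R →
      0 < k → R ^ lam * d ^ p ≤ R ^ (-(s * p)) * k ^ p →
      ∫⁻ x in (Metric.ball x₀ (R / 2))ᶜ,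
        ENNReal.ofReal (u x) ^ (p - 1) / ‖x - x₀‖ₑ ^ ((n : ℝ) + s * p) ≤
          ENNReal.ofReal (R ^ (-(s * p)) * k ^ (p - 1)) →
      (∀ r r' κ : ℝ, 0 < r → r < r' → r' ≤ R →
        CaccioppoliIneq s p d H lam (fun x => max (u x - κ) 0) {x | κ < u x} x₀ r r') →
      ∫⁻ x in Metric.ball x₀ R, ENNReal.ofReal (u x) ^ p ≤ ENNReal.ofReal (δ * k ^ p * R ^ n) →
      ∀ᵐ x ∂(volume.restrict (Metric.ball x₀ (R / 2))), u x ≤ k := by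
  have hω := unitBallVolume_pos n
  have hsp : 0 < s * p := by positivity
  have hp0 : 0 < p := by linarith
  set N := (n : ℝ) + s * p + p with hN
  have hN0 : 0 < N := by positivity
  set C₁ := 2 ^ (n + 1) / unitBallVolume n * (3 * H * 4 ^ N) with hC₁
  have hC₁0 : 0 < C₁ := by positivity
  -- `τ` shrinks the Faber–Krahn radius just fast enough that `τ^(j s p)` cancels the growth
  -- `2^(jN)` of the Caccioppoli constant.
  obtain ⟨τ, hτ0, hτ1, hτ⟩ : ∃ τ : ℝ, 0 < τ ∧ τ ≤ 1 ∧ τ ^ (s * p) * 2 ^ N = 1 := by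
    refine ⟨((2 : ℝ) ^ N)⁻¹ ^ (1 / (s * p)), by positivity, ?_, ?_⟩
    · refine Real.rpow_le_one (by positivity) ?_ (by positivity)
      exact inv_le_one_of_one_le₀ (Real.one_le_rpow (by norm_num) hN0.le)
    · rw [← Real.rpow_mul (by positivity), one_div, inv_mul_cancel₀ hsp.ne', Real.rpow_one,
        inv_mul_cancel₀ (by positivity)]
  -- The decay rate must beat the Chebyshev loss `2^(jp)` and leave `τ^(jn)`, the volume scale of a
  -- ball of radius `R ε τ^j`.
  set θ := ((2 : ℝ) ^ p)⁻¹ * τ ^ n with hθ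
  have hθ0 : 0 < θ := by positivity
  have hθ1 : θ < 1 := by
    have h1 : ((2 : ℝ) ^ p)⁻¹ < 1 := inv_lt_one_of_one_lt₀ (Real.one_lt_rpow (by norm_num) hp0)
    have h2 : τ ^ n ≤ 1 := pow_le_one₀ hτ0.le hτ1
    have h3 : 0 < ((2 : ℝ) ^ p)⁻¹ := by positivity
    nlinarith
  -- `ε` makes the constant of one step at most `θ`; `δ` is then fixed by the volume condition at
  -- step `0`.
  obtain ⟨ε, hε0, hε1, hε⟩ : ∃ ε : ℝ, 0 < ε ∧ ε ≤ 1 ∧ C₁ * ε ^ (s * p) ≤ θ := by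
    refine ⟨min 1 ((θ / C₁) ^ (1 / (s * p))), lt_min one_pos (by positivity), min_le_left _ _, ?_⟩
    calc C₁ * min 1 ((θ / C₁) ^ (1 / (s * p))) ^ (s * p)
        ≤ C₁ * ((θ / C₁) ^ (1 / (s * p))) ^ (s * p) := by gcongr; exact min_le_right _ _
      _ = θ := by
        rw [← Real.rpow_mul (by positivity), one_div, inv_mul_cancel₀ hsp.ne', Real.rpow_one]
        field_simp
  refine ⟨((2 : ℝ) ^ p)⁻¹ * (unitBallVolume n * (ε / 2) ^ n / 2), by positivity, ?_⟩
  set δ := ((2 : ℝ) ^ p)⁻¹ * (unitBallVolume n * (ε / 2) ^ n / 2) with hδ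
  intro d lam u x₀ R k hd hlam hu hR hk hdk htail hcac hY₀
  have key : ∀ j : ℕ, ∫⁻ x in Metric.ball x₀ (R / 2 * (1 + (1 / 2) ^ j)),
      ENNReal.ofReal (u x - k * (1 - (1 / 2) ^ j)) ^ p ≤
        ENNReal.ofReal (δ * k ^ p * R ^ n * θ ^ j) := by
    intro j
    induction j with
    | zero => simpa [show R / 2 * (1 + 1) = R by ring] using hY₀
    | succ j ih =>
      obtain ⟨h, hh⟩ : ∃ h : ℝ, h = (1 / 2) ^ j := ⟨_, rfl⟩
      rw [← hh] at ih
      have hh0 : 0 < h := by rw [hh]; positivity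
      have hh1 : h ≤ 1 := hh ▸ pow_le_one₀ (by norm_num) (by norm_num)
      have hκ : k * (1 - (1 / 2) ^ (j + 1)) = k * (1 - h) + k * (h / 2) := by rw [hh]; ring
      have hr : R / 2 * (1 + (1 / 2) ^ (j + 1)) = R / 2 * (1 + h / 2) := by rw [hh]; ring
      rw [hκ, hr]
      have hτj0 : 0 < τ ^ j := by positivity
      have hτj1 : τ ^ j ≤ 1 := pow_le_one₀ hτ0.le hτ1
      have h2j : ((2 : ℝ) ^ p) ^ j = h ^ (-p) := by
        rw [hh, Real.rpow_neg (by positivity), ← Real.rpow_natCast, ← Real.rpow_natCast,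
          ← Real.rpow_mul (by norm_num), ← Real.rpow_mul (by norm_num), one_div,
          Real.inv_rpow (by norm_num), inv_inv, mul_comm]
      have h2N : h ^ (-N) = ((2 : ℝ) ^ N) ^ j := by
        rw [hh, Real.rpow_neg (by positivity), ← Real.rpow_natCast, ← Real.rpow_natCast,
          ← Real.rpow_mul (by norm_num), ← Real.rpow_mul (by norm_num), one_div,
          Real.inv_rpow (by norm_num), inv_inv, mul_comm]
      have hρR : R * (ε * τ ^ j) ≤ R :=
        mul_le_of_le_one_right hR.le (mul_le_one₀ hε1 hτj0.le hτj1)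
      have hRh : 0 < R * h := by positivity
      have hRh1 : R * h ≤ R := mul_le_of_le_one_right hR.le hh1
      have hkh : 0 < k * h := by positivity
      -- The radii differ by `R h / 4` and the levels by `k h / 2`, so `σ = h / 4` serves both. With
      -- these `δ` and `θ` the volume condition holds with equality after the induction hypothesis.
      have hstep := lintegral_truncation_rpow_le (ρ := R * (ε * τ ^ j)) (r₁ := R / 2 * (1 + h / 2))
        (r₂ := R / 2 * (1 + h)) (κ := k * (1 - h)) (m := k * (h / 2)) (σ := h / 4) hn
        hs0 hs1 hp hH.le hd hlam hu hR (by linarith) (by linarith) (by positivity) (by linarith)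
        (by linarith) hk (by linarith) (mul_nonneg hk.le (by linarith)) hdk htail
        (hcac _ _ _ (by positivity) (by linarith) (by linarith)) (by positivity) hρR <| by
          refine (mul_le_mul_right ih _).trans ?_
          rw [← ENNReal.ofReal_mul (by positivity)]
          refine ENNReal.ofReal_le_ofReal (le_of_eq ?_)
          have e1 : ((k * (h / 2)) ^ p)⁻¹ = (k ^ p)⁻¹ * (2 ^ p * h ^ (-p)) := by
            rw [Real.mul_rpow hk.le (by positivity), Real.div_rpow hh0.le (by norm_num),
              Real.rpow_neg hh0.le]
            field_simp
          have hkp := Real.rpow_pos_of_pos hk p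
          have h2p : (0 : ℝ) < 2 ^ p := by positivity
          rw [e1, ← h2j, hδ, hθ, mul_pow (_ ⁻¹), inv_pow, ← pow_mul τ, mul_comm n j, pow_mul τ j n]
          field_simp
          rw [show ε * τ ^ j * R / 2 = ε / 2 * R * τ ^ j by ring, mul_pow, mul_pow]
      refine hstep.trans ((mul_le_mul_right ih _).trans ?_)
      rw [← ENNReal.ofReal_mul (by positivity)]
      refine ENNReal.ofReal_le_ofReal ?_
      have e2 : 2 ^ (n + 1) / unitBallVolume n * (R * (ε * τ ^ j)) ^ (s * p) *
          (3 * H * (R ^ (-(s * p)) * (h / 4) ^ (-N))) = C₁ * ε ^ (s * p) := by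
        have e3 : (h / 4) ^ (-N) = 4 ^ N * (2 ^ N) ^ j := by
          rw [← h2N, Real.div_rpow hh0.le (by norm_num), Real.rpow_neg (by norm_num : (0 : ℝ) ≤ 4)]
          field_simp
        have e4 : (τ ^ j) ^ (s * p) * (2 ^ N) ^ j = 1 := by
          rw [← Real.rpow_natCast τ j, ← Real.rpow_mul hτ0.le, mul_comm (j : ℝ),
            Real.rpow_mul hτ0.le, Real.rpow_natCast, ← mul_pow, hτ, one_pow]
        have e5 : R ^ (s * p) * R ^ (-(s * p)) = 1 := by
          rw [← Real.rpow_add hR, add_neg_cancel, Real.rpow_zero]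
        rw [Real.mul_rpow hR.le (by positivity), Real.mul_rpow hε0.le hτj0.le, e3, hC₁]
        linear_combination (2 ^ (n + 1) / unitBallVolume n * ε ^ (s * p) * 3 * H * 4 ^ N) *
          (R ^ (s * p) * R ^ (-(s * p)) * e4 + e5)
      rw [e2]
      calc C₁ * ε ^ (s * p) * (δ * k ^ p * R ^ n * θ ^ j)
          ≤ θ * (δ * k ^ p * R ^ n * θ ^ j) := by gcongr
        _ = δ * k ^ p * R ^ n * θ ^ (j + 1) := by ring
  -- The limit ball and level `k` lie inside every stage, so this integral is below each `Y_j`.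
  have hzero : ∫⁻ x in Metric.ball x₀ (R / 2), ENNReal.ofReal (u x - k) ^ p = 0 := by
    refine le_antisymm (ge_of_tendsto' (x := Filter.atTop)
      (f := fun j : ℕ => ENNReal.ofReal (δ * k ^ p * R ^ n * θ ^ j)) ?_ fun j => ?_) zero_le
    · rw [← ENNReal.ofReal_zero]
      refine ENNReal.tendsto_ofReal ?_
      simpa using (tendsto_pow_atTop_nhds_zero_of_lt_one hθ0.le hθ1).const_mul (δ * k ^ p * R ^ n)
    · refine le_trans ?_ (key j)
      have hj : (0 : ℝ) < (1 / 2) ^ j := by positivity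
      refine (lintegral_mono_set (Metric.ball_subset_ball (by nlinarith))).trans
        (lintegral_mono fun x => ENNReal.rpow_le_rpow (ENNReal.ofReal_le_ofReal ?_) hp0.le)
      nlinarith
  rw [lintegral_eq_zero_iff' ((hu.sub_const k).ennreal_ofReal.pow_const p).restrict] at hzero
  filter_upwards [hzero] with x hx
  rw [Pi.zero_apply, ENNReal.rpow_eq_zero_iff_of_pos hp0, ENNReal.ofReal_eq_zero] at hx
  linarith

/-! ### Changing the centre of balls and tails -/

/-- If `Ω` is not the whole space, the distance from `x` to the complement is attained at a frontier
point, so it is at least the distance to the frontier. -/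
lemma ball_subset_of_le_infDist_frontier {Ω : Set (EuclideanSpace ℝ (Fin n))}
    {x : EuclideanSpace ℝ (Fin n)} {r : ℝ} (hx : x ∈ Ω) (hr : r ≤ Metric.infDist x (frontier Ω)) :
    Metric.ball x r ⊆ Ω := by
  rcases eq_or_ne Ω Set.univ with h | h
  · rw [h]; exact Set.subset_univ _
  · obtain ⟨y, hy, hxy⟩ := exists_mem_frontier_infDist_compl_eq_dist hx h
    refine (Metric.ball_subset_ball (hr.trans ?_)).trans Metric.ball_infDist_compl_subset
    rw [hxy]
    exact Metric.infDist_le_dist_of_mem hy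

lemma div_le_mul_div_of_le {a b c e : ℝ≥0∞} (hc : c ≠ 0) (hc' : c ≠ ∞) (h : e ≤ c * b) :
    a / b ≤ c * (a / e) := by
  rw [← ENNReal.mul_div_mul_left a b hc hc', ← mul_div_assoc]
  exact ENNReal.div_le_div_left h _

/-- If `‖z‖ ≤ c ‖w‖` then the kernel at `w` is at most `c ^ N` times the kernel at `z`. -/
lemma div_enorm_rpow_le {a : ℝ≥0∞} {z w : EuclideanSpace ℝ (Fin n)} {c N : ℝ} (hc : 0 < c)
    (hN : 0 ≤ N) (h : ‖z‖ ≤ c * ‖w‖) :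
    a / ‖w‖ₑ ^ N ≤ ENNReal.ofReal (c ^ N) * (a / ‖z‖ₑ ^ N) := by
  refine div_le_mul_div_of_le (by simpa using Real.rpow_pos_of_pos hc N) ENNReal.ofReal_ne_top ?_
  rw [← ENNReal.ofReal_rpow_of_nonneg hc.le hN, ← ENNReal.mul_rpow_of_nonneg _ _ hN]
  refine ENNReal.rpow_le_rpow ?_ hN
  rw [← ofReal_norm, ← ofReal_norm, ← ENNReal.ofReal_mul hc.le]
  exact ENNReal.ofReal_le_ofReal h

/-- The `L^(p-1)` norm on a ball is controlled by the `L^p` norm. -/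
lemma lintegral_rpow_sub_one_le (hn : 1 ≤ n) (hp : 1 < p) {u : EuclideanSpace ℝ (Fin n) → ℝ}
    {x₀ : EuclideanSpace ℝ (Fin n)} {r t : ℝ} (hr : 0 ≤ r) (ht : 0 < t)
    (hI : ∫⁻ x in Metric.ball x₀ r, ENNReal.ofReal (u x) ^ p ≤
      ENNReal.ofReal (unitBallVolume n * r ^ n * t ^ p)) :
    ∫⁻ x in Metric.ball x₀ r, ENNReal.ofReal (u x) ^ (p - 1) ≤
      ENNReal.ofReal (2 * (unitBallVolume n * r ^ n * t ^ (p - 1))) := by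
  have hω := unitBallVolume_pos n
  have hp1 : 0 < p - 1 := by linarith
  -- Pointwise Young-type bound, by comparing `u x` with `t`.
  have hpt : ∀ x, ENNReal.ofReal (u x) ^ (p - 1) ≤
      ENNReal.ofReal (t ^ (p - 1)) + ENNReal.ofReal t⁻¹ * ENNReal.ofReal (u x) ^ p := by
    intro x
    rcases le_total (u x) t with h | h
    · refine le_add_right ?_
      rw [← ENNReal.ofReal_rpow_of_nonneg ht.le hp1.le]
      exact ENNReal.rpow_le_rpow (ENNReal.ofReal_le_ofReal h) hp1.le
    · refine le_add_left ?_
      have hu : 0 < u x := by linarith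
      rw [ENNReal.ofReal_rpow_of_nonneg hu.le hp1.le,
        ENNReal.ofReal_rpow_of_nonneg hu.le (by linarith), ← ENNReal.ofReal_mul (by positivity)]
      refine ENNReal.ofReal_le_ofReal ?_
      rw [inv_mul_eq_div, le_div_iff₀ ht]
      calc u x ^ (p - 1) * t ≤ u x ^ (p - 1) * u x := by gcongr
        _ = u x ^ p := by rw [← Real.rpow_add_one hu.ne', sub_add_cancel]
  refine (lintegral_mono hpt).trans ?_
  rw [lintegral_add_left measurable_const, setLIntegral_const,
    lintegral_const_mul' _ _ ENNReal.ofReal_ne_top, volume_ball_eq hn _ hr]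
  refine (add_le_add_right (mul_le_mul_right hI _) _).trans ?_
  rw [← ENNReal.ofReal_mul (by positivity), ← ENNReal.ofReal_mul (by positivity),
    ← ENNReal.ofReal_add (by positivity) (by positivity)]
  refine ENNReal.ofReal_le_ofReal (le_of_eq ?_)
  rw [show t ^ p = t ^ (p - 1) * t by rw [← Real.rpow_add_one ht.ne', sub_add_cancel]]
  field_simp
  ring

/-- Moving the centre of the tail. -/
lemma lintegral_compl_ball_le (hn : 1 ≤ n) (hs : 0 ≤ s) (hp : 1 < p)
    {u : EuclideanSpace ℝ (Fin n) → ℝ} {x₀ y : EuclideanSpace ℝ (Fin n)} {R t : ℝ} (hR : 0 < R)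
    (ht : 0 < t) (hy : y ∈ Metric.ball x₀ R)
    (hI : ∫⁻ x in Metric.ball x₀ (2 * R), ENNReal.ofReal (u x) ^ p ≤
      ENNReal.ofReal (unitBallVolume n * (2 * R) ^ n * t ^ p))
    (hT : ∫⁻ x in (Metric.ball x₀ R)ᶜ,
      ENNReal.ofReal (u x) ^ (p - 1) / ‖x - x₀‖ₑ ^ ((n : ℝ) + s * p) ≤
        ENNReal.ofReal (R ^ (-(s * p)) * t ^ (p - 1))) :
    ∫⁻ x in (Metric.ball y (R / 2))ᶜ,
      ENNReal.ofReal (u x) ^ (p - 1) / ‖x - y‖ₑ ^ ((n : ℝ) + s * p) ≤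
        ENNReal.ofReal (R ^ (-(s * p)) * ((3 ^ ((n : ℝ) + s * p) +
          2 ^ ((n : ℝ) + s * p) * (2 * (unitBallVolume n * 2 ^ n))) * t ^ (p - 1))) := by
  have hω := unitBallVolume_pos n
  have hN : 0 ≤ (n : ℝ) + s * p := by positivity
  -- Outside `B_R(x₀)` the kernels are comparable, since `|x - x₀| ≤ |x - y| + R ≤ 3 |x - y|`;
  -- inside, the kernel is bounded by `(R / 2)^(-(n + sp))` and the `L^p` bound takes over.
  have hsub : (Metric.ball y (R / 2))ᶜ ⊆ ((Metric.ball x₀ R)ᶜ ∩ (Metric.ball y (R / 2))ᶜ) ∪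
      (Metric.ball x₀ R ∩ (Metric.ball y (R / 2))ᶜ) := fun x hx => by
    by_cases h : x ∈ Metric.ball x₀ R
    · exact Or.inr ⟨h, hx⟩
    · exact Or.inl ⟨h, hx⟩
  refine (lintegral_mono_set hsub).trans ((lintegral_union_le _ _ _).trans ?_)
  rw [Metric.mem_ball, dist_eq_norm] at hy
  have hfar : ∀ x ∈ (Metric.ball y (R / 2))ᶜ, R / 2 ≤ ‖x - y‖ := fun x hx => by
    simpa [dist_eq_norm] using hx
  have h1 : ∫⁻ x in (Metric.ball x₀ R)ᶜ ∩ (Metric.ball y (R / 2))ᶜ,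
      ENNReal.ofReal (u x) ^ (p - 1) / ‖x - y‖ₑ ^ ((n : ℝ) + s * p) ≤
        ENNReal.ofReal (3 ^ ((n : ℝ) + s * p)) *
          ENNReal.ofReal (R ^ (-(s * p)) * t ^ (p - 1)) := by
    refine le_trans ?_ (mul_le_mul_right hT _)
    refine le_trans ?_ (mul_le_mul_right (lintegral_mono_set
      (Set.inter_subset_left (t := (Metric.ball y (R / 2))ᶜ))) _)
    rw [← lintegral_const_mul' _ _ ENNReal.ofReal_ne_top]
    refine setLIntegral_mono' (measurableSet_ball.compl.inter measurableSet_ball.compl)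
      fun x hx => div_enorm_rpow_le (by norm_num) hN ?_
    have := hfar x hx.2
    have := norm_add_le (x - y) (y - x₀)
    rw [sub_add_sub_cancel] at this
    linarith
  have h2 : ∫⁻ x in Metric.ball x₀ R ∩ (Metric.ball y (R / 2))ᶜ,
      ENNReal.ofReal (u x) ^ (p - 1) / ‖x - y‖ₑ ^ ((n : ℝ) + s * p) ≤
        ENNReal.ofReal ((R / 2) ^ ((n : ℝ) + s * p))⁻¹ *
          ENNReal.ofReal (2 * (unitBallVolume n * (2 * R) ^ n * t ^ (p - 1))) := by
    refine le_trans ?_ (mul_le_mul_right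
      (lintegral_rpow_sub_one_le hn hp (by positivity) ht hI) _)
    refine le_trans ?_ (mul_le_mul_right (lintegral_mono_set
      (Set.inter_subset_left.trans (Metric.ball_subset_ball (by linarith : R ≤ 2 * R)) :
        Metric.ball x₀ R ∩ (Metric.ball y (R / 2))ᶜ ⊆ _)) _)
    rw [← lintegral_const_mul' _ _ ENNReal.ofReal_ne_top]
    refine setLIntegral_mono' (measurableSet_ball.inter measurableSet_ball.compl) fun x hx => ?_
    rw [ENNReal.ofReal_inv_of_pos (by positivity), ← ENNReal.div_eq_inv_mul]
    refine ENNReal.div_le_div_left ?_ _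
    rw [← ENNReal.ofReal_rpow_of_nonneg (by positivity) hN, ← ofReal_norm]
    exact ENNReal.rpow_le_rpow (ENNReal.ofReal_le_ofReal (hfar x hx.2)) hN
  refine (add_le_add h1 h2).trans ?_
  rw [← ENNReal.ofReal_mul (by positivity), ← ENNReal.ofReal_mul (by positivity),
    ← ENNReal.ofReal_add (by positivity) (by positivity)]
  refine ENNReal.ofReal_le_ofReal (le_of_eq ?_)
  have e1 : ((R / 2) ^ ((n : ℝ) + s * p))⁻¹ * (2 * R) ^ n =
      R ^ (-(s * p)) * (2 ^ ((n : ℝ) + s * p) * 2 ^ n) := by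
    rw [Real.div_rpow hR.le (by norm_num), Real.rpow_add hR, Real.rpow_natCast, mul_pow,
      Real.rpow_neg hR.le]
    have := Real.rpow_pos_of_pos hR (s * p)
    field_simp
  linear_combination (2 * unitBallVolume n * t ^ (p - 1)) * e1

/-- A set that is null near each of its points is null, so uncountably many centres do no harm. -/
lemma ae_restrict_ball_of_forall_mem {P : EuclideanSpace ℝ (Fin n) → Prop}
    {x₀ : EuclideanSpace ℝ (Fin n)} {R r : ℝ} (hr : 0 < r)
    (h : ∀ y ∈ Metric.ball x₀ R, ∀ᵐ x ∂(volume.restrict (Metric.ball y r)), P x) :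
    ∀ᵐ x ∂(volume.restrict (Metric.ball x₀ R)), P x := by
  rw [ae_restrict_iff' measurableSet_ball, ae_iff]
  refine measure_null_of_locally_null _ fun y hy => ?_
  simp only [Set.mem_ofPred_eq, Classical.not_imp] at hy
  have hy' := h y hy.1
  rw [ae_restrict_iff' measurableSet_ball, ae_iff] at hy'
  refine ⟨_, ?_, hy'⟩
  filter_upwards [self_mem_nhdsWithin, mem_nhdsWithin_of_mem_nhds (Metric.ball_mem_nhds y hr)]
    with x hx hxr
  simp only [Classical.not_imp] at hx ⊢
  exact ⟨hxr, hx.2⟩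

/-! ### Local boundedness from above -/

/-- Local boundedness from above in `wDG⁺`, at every level exceeding the right-hand side. -/
lemma exists_forall_ae_le_mul (hn : 1 ≤ n) {H : ℝ}
    (hs0 : 0 < s) (hs1 : s < 1) (hp : 1 < p) (hH : 0 < H) :
    ∃ C : ℝ, 1 ≤ C ∧ ∀ (Ω : Set (EuclideanSpace ℝ (Fin n))) (d lam : ℝ), 0 ≤ d → 0 ≤ lam →
      ∀ u : EuclideanSpace ℝ (Fin n) → ℝ, MemWDGPlus s p d H lam Ω u →
      ∀ x₀ ∈ Ω, ∀ R : ℝ, 0 < R → R < Metric.infDist x₀ (frontier Ω) / 2 → ∀ t : ℝ, 0 < t →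
      (⨍⁻ x in Metric.ball x₀ (2 * R), ENNReal.ofReal (u x) ^ p ∂volume) ^ (1 / p) ≤
        ENNReal.ofReal t →
      tail s p (fun x => max (u x) 0) x₀ R ≤ ENNReal.ofReal t →
      ENNReal.ofReal (R ^ ((lam + s * p) / p) * d) ≤ ENNReal.ofReal t →
      ∀ᵐ x ∂(volume.restrict (Metric.ball x₀ R)), u x ≤ C * t := by
  obtain ⟨δ, hδ, hmain⟩ := exists_forall_ae_le_of_lintegral_le hn hs0 hs1 hp hH
  have hω := unitBallVolume_pos n
  have hp0 : 0 < p := by linarith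
  have hp1 : 0 < p - 1 := by linarith
  set K := 3 ^ ((n : ℝ) + s * p) + 2 ^ ((n : ℝ) + s * p) * (2 * (unitBallVolume n * 2 ^ n)) with hK
  have hK0 : 0 < K := by positivity
  have hpow : ∀ a q : ℝ, 0 < a → 0 < q → ∀ C, a ^ (1 / q) ≤ C → a ≤ C ^ q := by
    intro a q ha hq C h
    calc a = (a ^ (1 / q)) ^ q := by
          rw [← Real.rpow_mul ha.le, one_div, inv_mul_cancel₀ hq.ne', Real.rpow_one]
      _ ≤ C ^ q := by gcongr
  -- The power `C^p` secures the small energy at level `C t`, the power `C^(p-1)` absorbs the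
  -- constant of the recentred tail, and `C ≥ 1` suffices for the `d` term.
  obtain ⟨C, hC1, hCp, hCK⟩ : ∃ C : ℝ, 1 ≤ C ∧ unitBallVolume n * 2 ^ n / δ ≤ C ^ p ∧
      K ≤ C ^ (p - 1) :=
    ⟨max 1 (max ((unitBallVolume n * 2 ^ n / δ) ^ (1 / p)) (K ^ (1 / (p - 1)))), le_max_left _ _,
      hpow _ _ (by positivity) hp0 _ ((le_max_left _ _).trans (le_max_right _ _)),
      hpow _ _ hK0 hp1 _ ((le_max_right _ _).trans (le_max_right _ _))⟩
  have hC0 : 0 < C := by linarith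
  refine ⟨C, hC1, ?_⟩
  intro Ω d lam hd hlam u hu x₀ hx₀ R hR hRΩ t ht hM hT hD
  have hI : ∫⁻ x in Metric.ball x₀ (2 * R), ENNReal.ofReal (u x) ^ p ≤
      ENNReal.ofReal (unitBallVolume n * (2 * R) ^ n * t ^ p) := by
    rw [← measure_mul_setLAverage _ measure_ball_lt_top.ne, volume_ball_eq hn _ (by positivity),
      ENNReal.ofReal_mul (q := t ^ p) (by positivity),
      ← ENNReal.ofReal_rpow_of_nonneg ht.le hp0.le]
    refine mul_le_mul_right ?_ _
    refine le_trans (le_of_eq ?_) (ENNReal.rpow_le_rpow hM hp0.le)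
    rw [← ENNReal.rpow_mul, one_div, inv_mul_cancel₀ hp0.ne', ENNReal.rpow_one]
  have hT' : ∫⁻ x in (Metric.ball x₀ R)ᶜ,
      ENNReal.ofReal (u x) ^ (p - 1) / ‖x - x₀‖ₑ ^ ((n : ℝ) + s * p) ≤
        ENNReal.ofReal (R ^ (-(s * p)) * t ^ (p - 1)) := by
    have h := ENNReal.rpow_le_rpow hT hp1.le
    rw [tail_rpow hp, ENNReal.ofReal_rpow_of_nonneg ht.le hp1.le] at h
    simp only [enorm_max_zero] at h
    have h' := mul_le_mul_right h (ENNReal.ofReal (R ^ (-(s * p))))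
    rwa [← mul_assoc, ← ENNReal.ofReal_mul (by positivity), ← Real.rpow_add hR, neg_add_cancel,
      Real.rpow_zero, ENNReal.ofReal_one, one_mul, ← ENNReal.ofReal_mul (by positivity)] at h'
  have hdk : R ^ lam * d ^ p ≤ R ^ (-(s * p)) * (C * t) ^ p := by
    rw [ENNReal.ofReal_le_ofReal_iff ht.le] at hD
    have h1 : R ^ ((lam + s * p) / p) * d ≤ C * t := by nlinarith
    have h2 := Real.rpow_le_rpow (by positivity) h1 hp0.le
    rw [Real.mul_rpow (by positivity) hd, ← Real.rpow_mul hR.le, div_mul_cancel₀ _ hp0.ne'] at h2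
    calc R ^ lam * d ^ p = R ^ (-(s * p)) * (R ^ (lam + s * p) * d ^ p) := by
          rw [← mul_assoc, ← Real.rpow_add hR]
          ring_nf
      _ ≤ _ := by gcongr
  refine ae_restrict_ball_of_forall_mem (half_pos hR) fun y hy => ?_
  have hyΩ : y ∈ Ω := ball_subset_of_le_infDist_frontier hx₀ (by linarith) hy
  have hyR : R < Metric.infDist y (frontier Ω) := by
    have := Metric.infDist_le_infDist_add_dist (s := frontier Ω) (x := x₀) (y := y)
    rw [Metric.mem_ball'] at hy
    linarith
  refine hmain d lam u y R (C * t) hd hlam hu.memTailSpace.1 hR (by positivity) hdk ?_ ?_ ?_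
  · refine (lintegral_compl_ball_le hn hs0.le hp hR ht hy hI hT').trans
      (ENNReal.ofReal_le_ofReal ?_)
    rw [Real.mul_rpow hC0.le ht.le]
    gcongr
  · intro r r' κ hr hrr' hr'
    exact hu.caccioppoli y hyΩ r r' hr hrr' (by linarith) κ
  · refine (lintegral_mono_set (Metric.ball_subset_ball' ?_)).trans
      (hI.trans (ENNReal.ofReal_le_ofReal ?_))
    · rw [Metric.mem_ball] at hy
      linarith
    · rw [div_le_iff₀ hδ] at hCp
      calc unitBallVolume n * (2 * R) ^ n * t ^ p = unitBallVolume n * 2 ^ n * (t ^ p * R ^ n) := by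
            ring
        _ ≤ C ^ p * δ * (t ^ p * R ^ n) := by gcongr
        _ = δ * (C * t) ^ p * R ^ n := by rw [Real.mul_rpow hC0.le ht.le]; ring

/-- The one-sided local boundedness estimate in `wDG⁺`. -/
lemma exists_forall_ae_ofReal_le (hn : 1 ≤ n) {H : ℝ}
    (hs0 : 0 < s) (hs1 : s < 1) (hp : 1 < p) (hH : 0 < H) :
    ∃ C : ℝ≥0, 1 ≤ C ∧ ∀ (Ω : Set (EuclideanSpace ℝ (Fin n))) (d lam : ℝ), 0 ≤ d → 0 ≤ lam →
      ∀ u : EuclideanSpace ℝ (Fin n) → ℝ, MemWDGPlus s p d H lam Ω u →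
      ∀ x₀ ∈ Ω, ∀ R : ℝ, 0 < R → R < Metric.infDist x₀ (frontier Ω) / 2 →
      ∀ᵐ x ∂(volume.restrict (Metric.ball x₀ R)), ENNReal.ofReal (u x) ≤
        (C : ℝ≥0∞) * ((⨍⁻ x in Metric.ball x₀ (2 * R), ENNReal.ofReal (u x) ^ p ∂volume) ^ (1 / p)
          + tail s p (fun x => max (u x) 0) x₀ R
          + ENNReal.ofReal (R ^ ((lam + s * p) / p) * d)) := by
  obtain ⟨C, hC1, hC⟩ := exists_forall_ae_le_mul hn hs0 hs1 hp hH
  have hC0 : 0 < C := by linarith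
  refine ⟨C.toNNReal, by simpa using hC1, ?_⟩
  intro Ω d lam hd hlam u hu x₀ hx₀ R hR hRΩ
  set M := (⨍⁻ x in Metric.ball x₀ (2 * R), ENNReal.ofReal (u x) ^ p ∂volume) ^ (1 / p)
  set T := tail s p (fun x => max (u x) 0) x₀ R
  set D := ENNReal.ofReal (R ^ ((lam + s * p) / p) * d)
  rcases eq_or_ne (M + T + D) ∞ with htop | htop
  · rw [htop, ENNReal.mul_top (by simpa using hC0)]
    exact Filter.Eventually.of_forall fun _ => le_top
  -- The iteration needs a positive level, while the right-hand side may vanish; hence the excess `1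
  -- / (m + 1)`, removed in the limit.
  have hle : ∀ m : ℕ, ∀ᵐ x ∂(volume.restrict (Metric.ball x₀ R)),
      u x ≤ C * ((M + T + D).toReal + 1 / ((m : ℝ) + 1)) := by
    intro m
    have hm : 0 < 1 / ((m : ℝ) + 1) := by positivity
    have hE : M + T + D ≤ ENNReal.ofReal ((M + T + D).toReal + 1 / ((m : ℝ) + 1)) := by
      rw [ENNReal.le_ofReal_iff_toReal_le htop (by positivity)]
      linarith
    exact hC Ω d lam hd hlam u hu x₀ hx₀ R hR hRΩ _ (by positivity)
      ((le_self_add.trans le_self_add).trans hE) ((le_add_self.trans le_self_add).trans hE)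
      (le_add_self.trans hE)
  filter_upwards [ae_all_iff.2 hle] with x hx
  have hlim : u x ≤ C * ((M + T + D).toReal + 0) :=
    ge_of_tendsto' ((tendsto_one_div_add_atTop_nhds_zero_nat.const_add _).const_mul C) hx
  rw [add_zero] at hlim
  refine (ENNReal.ofReal_le_ofReal hlim).trans (le_of_eq ?_)
  rw [ENNReal.ofReal_mul hC0.le, ENNReal.ofReal_toReal htop]
  rfl

/-! ### Reflection, finiteness of the bound and local boundedness -/

lemma MemWDGMinus.neg {d H lam : ℝ} {Ω : Set (EuclideanSpace ℝ (Fin n))}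
    {u : EuclideanSpace ℝ (Fin n) → ℝ} (hu : MemWDGMinus s p d H lam Ω u) :
    MemWDGPlus s p d H lam Ω (fun x => -u x) := by
  refine ⟨⟨hu.memTailSpace.1.neg, by simpa using hu.memTailSpace.2⟩,
    ⟨hu.memFracSobolev.1.neg, ?_⟩, ?_⟩
  · have h : ∀ x y, ‖-u x - -u y‖ₑ = ‖u x - u y‖ₑ := fun x y => by
      rw [← enorm_neg]
      congr 1
      ring
    have h' := hu.memFracSobolev.2
    simp only [gagliardoSeminorm, h] at h' ⊢
    exact h'
  · intro x₀ hx₀ r R hr hrR hR k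
    have h := hu.caccioppoli x₀ hx₀ r R hr hrR hR (-k)
    have e1 : (fun x => max (-(u x - -k)) 0) = fun x => max (-u x - k) 0 := by
      funext x
      congr 1
      ring
    have e2 : {x | u x < -k} = {x | k < -u x} := by
      ext x
      simp only [Set.mem_ofPred_eq]
      exact lt_neg
    rwa [e1, e2] at h

lemma tail_mono (hp : 1 < p) {v w : EuclideanSpace ℝ (Fin n) → ℝ}
    {x₀ : EuclideanSpace ℝ (Fin n)} {R : ℝ} (h : ∀ x, ‖v x‖ₑ ≤ ‖w x‖ₑ) :
    tail s p v x₀ R ≤ tail s p w x₀ R := by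
  have hp1 : 0 < p - 1 := by linarith
  refine ENNReal.rpow_le_rpow (mul_le_mul_right (lintegral_mono fun x => ?_) _) (by positivity)
  exact ENNReal.div_le_div_right (ENNReal.rpow_le_rpow (h x) hp1.le) _

/-- Off `B_R(x₀)` one has `1 + |x| ≤ c |x - x₀|`, so the tail kernel is dominated by the weight of
the tail space. -/
lemma MemTailSpace.tail_lt_top (hs : 0 ≤ s) (hp : 1 < p) {u : EuclideanSpace ℝ (Fin n) → ℝ}
    (hu : MemTailSpace s p u) (x₀ : EuclideanSpace ℝ (Fin n)) {R : ℝ} (hR : 0 < R) :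
    tail s p u x₀ R < ∞ := by
  have hp1 : 0 < p - 1 := by linarith
  have hN : 0 ≤ (n : ℝ) + s * p := by positivity
  refine ENNReal.rpow_lt_top_of_nonneg (by positivity)
    (ENNReal.mul_lt_top ENNReal.ofReal_lt_top ?_).ne
  set c : ℝ := (1 + ‖x₀‖) / R + 1 with hc
  have hc0 : 0 < c := by positivity
  calc ∫⁻ x in (Metric.ball x₀ R)ᶜ, ‖u x‖ₑ ^ (p - 1) / ‖x - x₀‖ₑ ^ ((n : ℝ) + s * p)
      ≤ ∫⁻ x in (Metric.ball x₀ R)ᶜ, ENNReal.ofReal (c ^ ((n : ℝ) + s * p)) *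
          (‖u x‖ₑ ^ (p - 1) / (1 + ‖x‖ₑ) ^ ((n : ℝ) + s * p)) := by
        refine setLIntegral_mono' measurableSet_ball.compl fun x hx => ?_
        refine div_le_mul_div_of_le (by simpa using Real.rpow_pos_of_pos hc0 _)
          ENNReal.ofReal_ne_top ?_
        rw [← ENNReal.ofReal_rpow_of_nonneg hc0.le hN, ← ENNReal.mul_rpow_of_nonneg _ _ hN]
        refine ENNReal.rpow_le_rpow ?_ hN
        rw [← ofReal_norm, ← ofReal_norm, ← ENNReal.ofReal_mul hc0.le, ← ENNReal.ofReal_one,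
          ← ENNReal.ofReal_add zero_le_one (norm_nonneg _)]
        refine ENNReal.ofReal_le_ofReal ?_
        have hx' : R ≤ ‖x - x₀‖ := by simpa [dist_eq_norm] using hx
        have h1 : ‖x‖ ≤ ‖x - x₀‖ + ‖x₀‖ := by simpa using norm_add_le (x - x₀) x₀
        have h2 : 1 + ‖x₀‖ ≤ (1 + ‖x₀‖) / R * ‖x - x₀‖ := by
          rw [div_mul_eq_mul_div, le_div_iff₀ hR]
          gcongr
        rw [hc]
        linarith
    _ ≤ ENNReal.ofReal (c ^ ((n : ℝ) + s * p)) *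
          ∫⁻ x, ‖u x‖ₑ ^ (p - 1) / (1 + ‖x‖ₑ) ^ ((n : ℝ) + s * p) := by
        rw [← lintegral_const_mul' _ _ ENNReal.ofReal_ne_top]
        exact setLIntegral_le_lintegral _ _
    _ < ∞ := ENNReal.mul_lt_top ENNReal.ofReal_lt_top hu.2

lemma MemFracSobolev.laverage_lt_top (hp : 0 < p) {Ω : Set (EuclideanSpace ℝ (Fin n))}
    {u : EuclideanSpace ℝ (Fin n) → ℝ} (hu : MemFracSobolev s p u Ω)
    {x₀ : EuclideanSpace ℝ (Fin n)} {r : ℝ} (hr : 0 < r) (hball : Metric.ball x₀ r ⊆ Ω) :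
    ⨍⁻ x in Metric.ball x₀ r, ‖u x‖ₑ ^ p ∂volume < ∞ := by
  rw [setLAverage_eq]
  refine ENNReal.div_lt_top ?_ (Metric.measure_ball_pos _ _ hr).ne'
  refine ((lintegral_mono_set hball).trans_lt ?_).ne
  rw [← eLpNorm_ofReal_rpow hp]
  exact ENNReal.rpow_lt_top_of_nonneg hp.le hu.1.2.ne

lemma infDist_frontier_pos (hn : 1 ≤ n) {Ω : Set (EuclideanSpace ℝ (Fin n))} (hΩ : IsOpen Ω)
    (hb : Bornology.IsBounded Ω) {x : EuclideanSpace ℝ (Fin n)} (hx : x ∈ Ω) :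
    0 < Metric.infDist x (frontier Ω) := by
  have : NeZero n := ⟨by omega⟩
  -- `Metric.infDist` to the empty set is `0` by convention; boundedness of `Ω` rules out an empty
  -- frontier.
  have hne : (frontier Ω).Nonempty := nonempty_frontier_iff.2 ⟨⟨x, hx⟩, fun h =>
    NormedSpace.unbounded_univ ℝ (EuclideanSpace ℝ (Fin n)) (h ▸ hb)⟩
  refine (isClosed_frontier.notMem_iff_infDist_pos hne).1 fun h => ?_
  rw [hΩ.frontier_eq] at h
  exact h.2 hx

lemma memLinftyLoc_of_forall_mem {Ω : Set (EuclideanSpace ℝ (Fin n))}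
    {u : EuclideanSpace ℝ (Fin n) → ℝ} (hu : AEMeasurable u)
    (h : ∀ x ∈ Ω, ∃ R > 0, eLpNorm u ∞ (volume.restrict (Metric.ball x R)) < ∞) :
    MemLinftyLoc Ω u := by
  intro K hKΩ hK
  obtain ⟨c, hc⟩ : ∃ c : ℝ≥0, ∀ᵐ x ∂(volume.restrict K), ‖u x‖ₑ ≤ c := by
    refine hK.induction_on (p := fun S => ∃ c : ℝ≥0, ∀ᵐ x ∂(volume.restrict S), ‖u x‖ₑ ≤ c)
      ⟨0, by simp⟩ ?_ ?_ ?_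
    · rintro S T hST ⟨c, hc⟩
      exact ⟨c, ae_restrict_of_ae_restrict_of_subset hST hc⟩
    · rintro S T ⟨c, hc⟩ ⟨c', hc'⟩
      refine ⟨max c c', (ae_restrict_union_iff _ _ _).2 ⟨?_, ?_⟩⟩
      · filter_upwards [hc] with x hx
        exact hx.trans (by exact_mod_cast le_max_left c c')
      · filter_upwards [hc'] with x hx
        exact hx.trans (by exact_mod_cast le_max_right c c')
    · intro x hx
      obtain ⟨R, hR, hlt⟩ := h x (hKΩ hx)
      refine ⟨_, mem_nhdsWithin_of_mem_nhds (Metric.ball_mem_nhds x hR),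
        (eLpNorm u ∞ (volume.restrict (Metric.ball x R))).toNNReal, ?_⟩
      rw [ENNReal.coe_toNNReal hlt.ne, eLpNorm_exponent_top]
      exact enorm_ae_le_eLpNormEssSup _ _
  refine ⟨hu.aestronglyMeasurable.restrict, ?_⟩
  rw [eLpNorm_exponent_top]
  exact (eLpNormEssSup_le_of_ae_enorm_bound hc).trans_lt ENNReal.coe_lt_top

end FracDeGiorgi

theorem theorem2p2 (n : ℕ) (hn : 1 ≤ n) (s p H : ℝ) (hs0 : 0 < s) (hs1 : s < 1) (hp : 1 < p)
    (hsp : s * p < (n : ℝ)) (hH : 1 ≤ H) :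
    -- local boundedness of functions in `wDG`, with the two-sided estimate
    (∃ C : ℝ≥0, 1 ≤ C ∧
      ∀ Ω : Set (EuclideanSpace ℝ (Fin n)), IsOpen Ω → Bornology.IsBounded Ω →
      ∀ d lam : ℝ, 0 ≤ d → 0 ≤ lam →
      ∀ u : EuclideanSpace ℝ (Fin n) → ℝ, FracDeGiorgi.MemWDG s p d H lam Ω u →
        FracDeGiorgi.MemLinftyLoc Ω u ∧
        ∀ x₀ ∈ Ω, ∀ R : ℝ, 0 < R → R < Metric.infDist x₀ (frontier Ω) / 2 →
          eLpNorm u ∞ (volume.restrict (Metric.ball x₀ R)) ≤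
            (C : ℝ≥0∞) * ((⨍⁻ x in Metric.ball x₀ (2 * R), ‖u x‖ₑ ^ p ∂volume) ^ (1 / p)
              + FracDeGiorgi.tail s p u x₀ R
              + ENNReal.ofReal (R ^ ((lam + s * p) / p) * d))) ∧
    -- the one-sided estimate for functions in `wDG⁺`
    (∃ C : ℝ≥0, 1 ≤ C ∧
      ∀ Ω : Set (EuclideanSpace ℝ (Fin n)), IsOpen Ω → Bornology.IsBounded Ω →
      ∀ d lam : ℝ, 0 ≤ d → 0 ≤ lam →
      ∀ u : EuclideanSpace ℝ (Fin n) → ℝ, FracDeGiorgi.MemWDGPlus s p d H lam Ω u →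
        ∀ x₀ ∈ Ω, ∀ R : ℝ, 0 < R → R < Metric.infDist x₀ (frontier Ω) / 2 →
          essSup (fun x => (u x : EReal)) (volume.restrict (Metric.ball x₀ R)) ≤
            (((C : ℝ≥0∞) * ((⨍⁻ x in Metric.ball x₀ (2 * R), ENNReal.ofReal (u x) ^ p ∂volume) ^ (1 / p)
              + FracDeGiorgi.tail s p (fun x => max (u x) 0) x₀ R
              + ENNReal.ofReal (R ^ ((lam + s * p) / p) * d)) : ℝ≥0∞) : EReal)) := by
  have hp0 : 0 < p := by linarith
  obtain ⟨C, hC1, hC⟩ := FracDeGiorgi.exists_forall_ae_ofReal_le hn hs0 hs1 hp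
    (by linarith : 0 < H)
  refine ⟨⟨C, hC1, ?_⟩, C, hC1, ?_⟩
  · intro Ω hΩ hb d lam hd hlam u hu
    have hest : ∀ x₀ ∈ Ω, ∀ R : ℝ, 0 < R → R < Metric.infDist x₀ (frontier Ω) / 2 →
        eLpNorm u ∞ (volume.restrict (Metric.ball x₀ R)) ≤
          (C : ℝ≥0∞) * ((⨍⁻ x in Metric.ball x₀ (2 * R), ‖u x‖ₑ ^ p ∂volume) ^ (1 / p)
            + FracDeGiorgi.tail s p u x₀ R
            + ENNReal.ofReal (R ^ ((lam + s * p) / p) * d)) := by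
      intro x₀ hx₀ R hR hRΩ
      rw [eLpNorm_exponent_top]
      refine eLpNormEssSup_le_of_ae_enorm_bound ?_
      have hmono : ∀ v : EuclideanSpace ℝ (Fin n) → ℝ, (∀ x, ENNReal.ofReal (v x) ≤ ‖u x‖ₑ) →
          (C : ℝ≥0∞) * ((⨍⁻ x in Metric.ball x₀ (2 * R), ENNReal.ofReal (v x) ^ p ∂volume) ^ (1 / p)
            + FracDeGiorgi.tail s p (fun x => max (v x) 0) x₀ R
            + ENNReal.ofReal (R ^ ((lam + s * p) / p) * d)) ≤
          (C : ℝ≥0∞) * ((⨍⁻ x in Metric.ball x₀ (2 * R), ‖u x‖ₑ ^ p ∂volume) ^ (1 / p)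
            + FracDeGiorgi.tail s p u x₀ R
            + ENNReal.ofReal (R ^ ((lam + s * p) / p) * d)) := by
        intro v hv
        refine mul_le_mul_right (add_le_add_left (add_le_add ?_ ?_) _) _
        · exact ENNReal.rpow_le_rpow (lintegral_mono fun x => ENNReal.rpow_le_rpow (hv x) hp0.le)
            (by positivity)
        · refine FracDeGiorgi.tail_mono hp fun x => ?_
          rw [FracDeGiorgi.enorm_max_zero]
          exact hv x
      filter_upwards [hC Ω d lam hd hlam u hu.1 x₀ hx₀ R hR hRΩ,
        hC Ω d lam hd hlam _ hu.2.neg x₀ hx₀ R hR hRΩ] with x h1 h2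
      rcases le_total 0 (u x) with h | h
      · rw [Real.enorm_of_nonneg h]
        exact h1.trans (hmono u fun x => Real.ofReal_le_enorm _)
      · rw [← enorm_neg, Real.enorm_of_nonneg (by linarith)]
        exact h2.trans (hmono _ fun x => by rw [← enorm_neg]; exact Real.ofReal_le_enorm _)
    refine ⟨FracDeGiorgi.memLinftyLoc_of_forall_mem hu.1.memTailSpace.1 fun x hx => ?_, hest⟩
    have hpos := FracDeGiorgi.infDist_frontier_pos hn hΩ hb hx
    -- A quarter of the distance keeps the doubled ball inside `Ω`, where `u` is in `L^p`.
    refine ⟨Metric.infDist x (frontier Ω) / 4, by positivity,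
      (hest x hx _ (by positivity) (by linarith)).trans_lt ?_⟩
    refine ENNReal.mul_lt_top ENNReal.coe_lt_top (ENNReal.add_lt_top.2 ⟨ENNReal.add_lt_top.2
      ⟨ENNReal.rpow_lt_top_of_nonneg (by positivity) (hu.1.memFracSobolev.laverage_lt_top hp0
        (by positivity) ?_).ne, hu.1.memTailSpace.tail_lt_top hs0.le hp x (by positivity)⟩,
      ENNReal.ofReal_lt_top⟩)
    exact FracDeGiorgi.ball_subset_of_le_infDist_frontier hx (by linarith)
  · intro Ω _ _ d lam hd hlam u hu x₀ hx₀ R hR hRΩ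
    refine essSup_le_of_ae_le _ ?_
    filter_upwards [hC Ω d lam hd hlam u hu x₀ hx₀ R hR hRΩ] with x hx
    refine le_trans ?_ (EReal.coe_ennreal_le_coe_ennreal_iff.2 hx)
    rw [EReal.coe_ennreal_ofReal]
    -- The cast of `ENNReal.ofReal (u x)` is the positive part, which dominates `u x` of either
    -- sign.
    exact EReal.coe_le_coe_iff.2 (le_max_left _ _)
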